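/- A gyrogroup is a nonempty set $G$ with a binary operation $\oplus$ such that: there is a unique identity element $1\in G$ with $1\oplus g=g=g\oplus 1$ for all $g\in G$; each $g\in G$ has a unique inverse $\ominus g$ with $\ominus g\oplus g=1=g\oplus(\ominus g)$; for all $g,h\in G$ there is an automorphism $\mathrm{gyr}[g,h]$ of $(G,\oplus)$ with $g\oplus(h\oplus f)=(g\oplus h)\oplus \mathrm{gyr}[g,h](f)$ for all $f\in G$; and $\mathrm{gyr}[g,h]=\mathrm{gyr}[g\oplus h,h]$ for all $g,h\in G$. A subgyrogroup is a nonempty subset closed under $\oplus$ and $\ominus$. A strongly topologically orderable gyrogroup is a gyrogroup $G$ with a topology such that $\oplus:G\times G\to G$ and $\ominus:G\to G$ are continuous, there is a neighborhood base $\mathcal U$ at $1$ with $\mathrm{gyr}[x,y](U)=U$ for all $x,y\in G$ and $U\in\mathcal U$, and the topology of $G$ is the order topology of some total order on $G$. A subset $S\subseteq G$ is a suitable set for $G$ if $S$ is discrete in the subspace topology, $S\cup\{1\}$ is closed in $G$, and the subgyrogroup generated by $S$ is dense in $G$. Theorem. Let $G$ be a strongly topologically orderable gyrogroup in which $\{1\}$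 is a $G_\delta$-set. Then $G$ is metrizable and $G$ has a suitable set. -/

import Mathlib

open Topology

/-- A gyrogroup, written multiplicatively: `a * b` is `a ⊕ b` and `a⁻¹` is `⊖ a`. The gyration `gyr a b`
is an automorphism of the magma `(G, *)`. Uniqueness of the identity and of inverses
is automatic (see `Gyrogroup.eq_one_of_isIdentity`, `Gyrogroup.eq_inv_of_isInverse`), and the gyrations
are determined by the operation (see `Gyrogroup.gyr_unique`). -/
class Gyrogroup (G : Type*) extends One G, Mul G, Inv G where
  protected one_mul : ∀ g : G, 1 * g = g
  protected mul_one : ∀ g : G, g * 1 = g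
  protected inv_mul_cancel : ∀ g : G, g⁻¹ * g = 1
  protected mul_inv_cancel : ∀ g : G, g * g⁻¹ = 1
  /-- The gyroautomorphism `gyr[g, h]`. -/
  gyr : G → G → MulAut G
  /-- Left gyroassociative law. -/
  gyroassoc : ∀ g h f : G, g * (h * f) = (g * h) * gyr g h f
  /-- Left loop property. -/
  left_loop : ∀ g h : G, gyr g h = gyr (g * h) h

namespace Gyrogroup

variable {G : Type*} [Gyrogroup G]

theorem mul_left_cancel {a b c : G} (h : a * b = a * c) : b = c := by
  have key : ∀ x : G, a⁻¹ * (a * x) = gyr a⁻¹ a x := fun x => by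
    rw [gyroassoc, Gyrogroup.inv_mul_cancel, Gyrogroup.one_mul]
  exact (gyr a⁻¹ a).injective (by rw [← key, ← key, h])

theorem eq_one_of_isIdentity {e : G} (h : ∀ g : G, e * g = g ∧ g * e = g) : e = 1 := by
  rw [← (h 1).1, Gyrogroup.mul_one]

theorem eq_inv_of_isInverse {g x : G} (h : x * g = 1 ∧ g * x = 1) : x = g⁻¹ :=
  mul_left_cancel (h.2.trans (Gyrogroup.mul_inv_cancel g).symm)

theorem gyr_unique {g h : G} (φ : G → G) (hφ : ∀ f : G, g * (h * f) = (g * h) * φ f) :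
    φ = gyr g h := by
  funext f
  exact mul_left_cancel ((hφ f).symm.trans (gyroassoc g h f))

end Gyrogroup

/-- A subset `H` of a gyrogroup is a subgyrogroup if it is nonempty and closed under the
operation and under inversion. -/
structure IsSubgyrogroup {G : Type*} [Gyrogroup G] (H : Set G) : Prop where
  nonempty : H.Nonempty
  inv_mem : ∀ a ∈ H, a⁻¹ ∈ H
  mul_mem : ∀ a ∈ H, ∀ b ∈ H, a * b ∈ H

/-- The subgyrogroup generated by `S`: the intersection of all subgyrogroups containing `S`. -/
def generatedSubgyrogroup {G : Type*} [Gyrogroup G] (S : Set G) : Set G :=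
  ⋂₀ {H : Set G | IsSubgyrogroup H ∧ S ⊆ H}

theorem isSubgyrogroup_generatedSubgyrogroup {G : Type*} [Gyrogroup G] (S : Set G) :
    IsSubgyrogroup (generatedSubgyrogroup S) where
  nonempty := by
    refine ⟨1, fun H hH => ?_⟩
    obtain ⟨a, ha⟩ := hH.1.nonempty
    rw [← Gyrogroup.inv_mul_cancel a]
    exact hH.1.mul_mem _ (hH.1.inv_mem a ha) _ ha
  inv_mem := fun a ha H hH => hH.1.inv_mem a (ha H hH)
  mul_mem := fun a ha b hb H hH => hH.1.mul_mem a (ha H hH) b (hb H hH)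

/-- A topological gyrogroup: the operation and the inversion are continuous. -/
class TopologicalGyrogroup (G : Type*) [Gyrogroup G] [TopologicalSpace G] : Prop
    extends ContinuousMul G, ContinuousInv G

/-- A strongly topological gyrogroup: there is a neighbourhood base `𝓤` at the identity all of
whose members are invariant under all gyrations. -/
class StronglyTopologicalGyrogroup (G : Type*) [Gyrogroup G] [TopologicalSpace G] : Prop
    extends TopologicalGyrogroup G where
  exists_gyr_invariant_base : ∃ 𝓤 : Set (Set G), (𝓝 (1 : G)).HasBasis (fun U => U ∈ 𝓤) id ∧
    ∀ U ∈ 𝓤, ∀ x y : G, (fun z => Gyrogroup.gyr x y z) '' U = U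

/-- A strongly topologically orderable gyrogroup: a strongly topological gyrogroup whose topology
is the order topology of some total order (no compatibility of the order with the operation). -/
class StronglyTopologicallyOrderableGyrogroup (G : Type*) [Gyrogroup G] [TopologicalSpace G] : Prop
    extends StronglyTopologicalGyrogroup G where
  exists_linearOrder : ∃ _ : LinearOrder G, OrderTopology G

/-- A suitable set: `S` is discrete in the subspace topology, `S ∪ {1}` is closed, and the
subgyrogroup generated by `S` is dense. -/
structure IsSuitableSet {G : Type*} [Gyrogroup G] [TopologicalSpace G] (S : Set G) : Prop where
  isDiscrete : IsDiscrete S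
  isClosed : IsClosed (S ∪ {1})
  dense : Dense (generatedSubgyrogroup S)

/-!
An order topology at a point `x` with `{x}` a Gδ-set is first countable: picking one interval inside
each of the open sets that intersect in `{x}` gives countable sets cofinal on either side of `x`. So
only first countability at `1` matters from then on.

The relations `x⁻¹ * y ∈ U`, with `U` a symmetric gyration-invariant neighbourhood of `1`, generate
a uniform structure; as it has a countable base, `G` is metrizable. For a suitable set, take a base
`V 0 ⊇ V 1 ⊇ …` of such neighbourhoods, a maximal `V 0`-separated set `A` in `G`, and a maximal
`V (n + 1)`-separated set `B n` in each `V n`. These sets have no accumulation points and the `B n`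
shrink to `1`, so `1` is the only possible accumulation point of their union. The union generates a
dense subgyrogroup `H`: every point is `V 0`-close to `A`, and if `x` is `V n`-close to `h ∈ H`
then `h⁻¹ * x ∈ V n` is `V (n + 1)`-close to some `b ∈ B n`, so that `x` is `V (n + 1)`-close
to `h * b`.
-/

open Filter Set
open scoped Uniformity

section Order

variable {X : Type*} [TopologicalSpace X] [LinearOrder X] [OrderTopology X]

theorem exists_countable_cofinal_Iio_of_isGδ_singleton {x : X} (hx : IsGδ ({x} : Set X)) :
    ∃ C : Set X, C.Countable ∧ C ⊆ Iio x ∧ ∀ l < x, ∃ c ∈ C, l ≤ c := by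
  by_cases hne : ∃ l, l < x
  · obtain ⟨U, hU, hxU⟩ := hx.eq_iInter_nat
    have hmem : ∀ n, x ∈ U n := fun n => mem_iInter.1 (hxU ▸ mem_singleton x) n
    choose c hcx hcU using fun n => exists_Ioc_subset_of_mem_nhds ((hU n).mem_nhds (hmem n)) hne
    refine ⟨range c, countable_range c, range_subset_iff.2 hcx, fun l hl => ?_⟩
    by_contra! hlt
    have hlU : l ∈ ⋂ n, U n := mem_iInter.2 fun n => hcU n ⟨hlt _ (mem_range_self n), hl.le⟩
    exact hl.ne (by rwa [← hxU] at hlU)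
  · exact ⟨∅, countable_empty, empty_subset _, fun l hl => (hne ⟨l, hl⟩).elim⟩

theorem isCountablyGenerated_iInf_principal_Ioi_of_isGδ_singleton {x : X}
    (hx : IsGδ ({x} : Set X)) : (⨅ l ∈ Iio x, 𝓟 (Ioi l)).IsCountablyGenerated := by
  obtain ⟨C, hC, hCx, hcofinal⟩ := exists_countable_cofinal_Iio_of_isGδ_singleton hx
  have hinf : ⨅ l ∈ Iio x, 𝓟 (Ioi l) = ⨅ l ∈ C, 𝓟 (Ioi l) := by
    refine le_antisymm (biInf_mono hCx) (le_iInf₂ fun l hl => ?_)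
    obtain ⟨c, hc, hlc⟩ := hcofinal l hl
    exact iInf₂_le_of_le c hc (principal_mono.2 (Ioi_subset_Ioi hlc))
  have : Countable C := hC.to_subtype
  rw [hinf, iInf_subtype']
  infer_instance

theorem isCountablyGenerated_nhds_of_isGδ_singleton {x : X} (hx : IsGδ ({x} : Set X)) :
    (𝓝 x).IsCountablyGenerated := by
  have := isCountablyGenerated_iInf_principal_Ioi_of_isGδ_singleton hx
  have : (⨅ u ∈ Ioi x, 𝓟 (Iio u)).IsCountablyGenerated :=
    isCountablyGenerated_iInf_principal_Ioi_of_isGδ_singleton (X := Xᵒᵈ) hx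
  rw [nhds_eq_order]
  infer_instance

end Order

section DerivedSet

variable {X : Type*} [TopologicalSpace X]

theorem isDiscrete_of_disjoint_derivedSet {S : Set X} (hS : Disjoint S (derivedSet S)) :
    IsDiscrete S :=
  isDiscrete_iff_nhdsNE.2 fun _ hx => not_neBot.1 (disjoint_left.1 hS hx)

theorem isClosed_union_of_derivedSet_subset {S T : Set X} (hT : IsClosed T)
    (hST : derivedSet S ⊆ T) : IsClosed (S ∪ T) := by
  rw [isClosed_iff_derivedSet_subset, derivedSet_union]
  exact union_subset (hST.trans subset_union_right)
    (((isClosed_iff_derivedSet_subset T).1 hT).trans subset_union_right)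

theorem derivedSet_iUnion_subset_singleton [T2Space X] {ι : Type*} {A : ι → Set X} {p : X}
    (hAp : Tendsto A cofinite (𝓝 p).smallSets) (hA : ∀ i, derivedSet (A i) = ∅) :
    derivedSet (⋃ i, A i) ⊆ {p} := by
  intro x hx
  by_contra hxp
  obtain ⟨M, N, hM, hN, hMN⟩ := t2_separation_nhds hxp
  have hfar : {i | ¬A i ⊆ N}.Finite := tendsto_smallSets_iff.1 hAp N hN
  have havoid : ∀ i, ∀ᶠ y in 𝓝[≠] x, y ∉ A i := fun i => by
    have hxA : x ∉ derivedSet (A i) := by simp only [hA, mem_empty_iff_false, not_false_eq_true]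
    rwa [mem_derivedSet, accPt_iff_frequently_nhdsNE, not_frequently] at hxA
  refine (accPt_iff_frequently_nhdsNE.1 hx) ?_
  filter_upwards [mem_nhdsWithin_of_mem_nhds hM, (eventually_all_finite hfar).2 fun i _ => havoid i]
    with y hyM hyfar hyA
  obtain ⟨i, hyi⟩ := mem_iUnion.1 hyA
  by_cases hi : A i ⊆ N
  · exact disjoint_left.1 hMN hyM (hi hyi)
  · exact hyfar i hi hyi

end DerivedSet

section Separated

variable {X : Type*}

theorem exists_isSeparated_isCover (R : SetRel X X) [R.IsRefl] [R.IsSymm] (s : Set X) :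
    ∃ N ⊆ s, R.IsSeparated N ∧ R.IsCover s N := by
  obtain ⟨N, hN⟩ := zorn_subset {N | N ⊆ s ∧ R.IsSeparated N} fun c hc hchain =>
    ⟨⋃₀ c, ⟨sUnion_subset fun N hN => (hc hN).1,
      (pairwise_sUnion hchain.directedOn).2 fun N hN => (hc hN).2⟩,
      fun _ => subset_sUnion_of_mem⟩
  exact ⟨N, hN.prop.1, hN.prop.2, .of_maximal_isSeparated hN⟩

variable [UniformSpace X]

theorem derivedSet_eq_empty_of_isSeparated [T0Space X] {V : SetRel X X} (hV : V ∈ 𝓤 X)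
    {s : Set X} (hs : V.IsSeparated s) : derivedSet s = ∅ := by
  refine eq_empty_of_forall_notMem fun x hx => ?_
  have hclosed : IsClosed (s \ {x}) := isClosed_of_spaced_out hV (hs.mono_right sdiff_subset)
  rw [mem_derivedSet, accPt_principal_iff_clusterPt, ← mem_closure_iff_clusterPt,
    hclosed.closure_eq] at hx
  exact hx.2 rfl

theorem dense_of_forall_isCover {ι : Sort*} {p : ι → Prop} {V : ι → SetRel X X}
    (hV : (𝓤 X).HasBasis p V) {s : Set X} (hs : ∀ i, p i → (V i).IsCover univ s) : Dense s :=
  fun x => (mem_closure_iff_nhds_basis (nhds_basis_uniformity' hV)).2 fun i hi =>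
    hs i hi (mem_univ x)

end Separated

namespace Gyrogroup

section Algebra

variable {G : Type*} [Gyrogroup G]

protected theorem inv_mul_cancel_left (a x : G) : a⁻¹ * (a * x) = x := by
  have hgyr : gyr a⁻¹ a x = x := by
    have hassoc := gyroassoc 1 a x
    rw [Gyrogroup.one_mul, Gyrogroup.one_mul] at hassoc
    rw [left_loop, Gyrogroup.inv_mul_cancel, ← mul_left_cancel hassoc]
  rw [gyroassoc, Gyrogroup.inv_mul_cancel, Gyrogroup.one_mul, hgyr]

protected theorem inv_inv (a : G) : a⁻¹⁻¹ = a :=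
  (eq_inv_of_isInverse ⟨Gyrogroup.mul_inv_cancel a, Gyrogroup.inv_mul_cancel a⟩).symm

protected theorem inv_one : (1 : G)⁻¹ = 1 :=
  (eq_inv_of_isInverse ⟨Gyrogroup.one_mul 1, Gyrogroup.one_mul 1⟩).symm

protected theorem mul_inv_cancel_left (a x : G) : a * (a⁻¹ * x) = x := by
  simpa only [Gyrogroup.inv_inv] using Gyrogroup.inv_mul_cancel_left a⁻¹ x

theorem inv_mul_mul_gyr (a b c : G) : (a⁻¹ * b) * gyr a⁻¹ b (b⁻¹ * c) = a⁻¹ * c := by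
  rw [← gyroassoc, Gyrogroup.mul_inv_cancel_left]

theorem inv_mul_inv_rev (a b : G) : (a⁻¹ * b)⁻¹ = gyr a⁻¹ b (b⁻¹ * a) := by
  apply mul_left_cancel (a := a⁻¹ * b)
  rw [inv_mul_mul_gyr, Gyrogroup.mul_inv_cancel, Gyrogroup.inv_mul_cancel]

theorem mul_inv_mul_eq_gyr (a b c : G) : (a * b)⁻¹ * c = gyr a b (b⁻¹ * (a⁻¹ * c)) := by
  apply mul_left_cancel (a := a * b)
  rw [Gyrogroup.mul_inv_cancel_left, ← gyroassoc, Gyrogroup.mul_inv_cancel_left,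
    Gyrogroup.mul_inv_cancel_left]

section Hom

variable {H F : Type*} [Gyrogroup H] [FunLike F G H] [MulHomClass F G H]

protected theorem map_one (φ : F) : φ 1 = 1 := by
  apply mul_left_cancel (a := φ 1)
  rw [← map_mul, Gyrogroup.mul_one, Gyrogroup.mul_one]

protected theorem map_inv (φ : F) (a : G) : φ a⁻¹ = (φ a)⁻¹ := by
  apply mul_left_cancel (a := φ a)
  rw [← map_mul, Gyrogroup.mul_inv_cancel, Gyrogroup.mul_inv_cancel, Gyrogroup.map_one]

end Hom

theorem one_mem_of_isSubgyrogroup {H : Set G} (hH : IsSubgyrogroup H) : 1 ∈ H := by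
  obtain ⟨a, ha⟩ := hH.nonempty
  rw [← Gyrogroup.inv_mul_cancel a]
  exact hH.mul_mem _ (hH.inv_mem a ha) _ ha

theorem subset_generatedSubgyrogroup (S : Set G) : S ⊆ generatedSubgyrogroup S :=
  fun _ hx _ hH => hH.2 hx

theorem generatedSubgyrogroup_diff_one (S : Set G) :
    generatedSubgyrogroup (S \ {1}) = generatedSubgyrogroup S := by
  have hiff : ∀ H : Set G, IsSubgyrogroup H ∧ S \ {1} ⊆ H ↔ IsSubgyrogroup H ∧ S ⊆ H := fun H =>
    and_congr_right fun hH => by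
      rw [sdiff_subset_iff, singleton_union, insert_eq_of_mem (one_mem_of_isSubgyrogroup hH)]
  simp only [generatedSubgyrogroup, hiff]

/-- Stability of a set under inversion and under all gyrations. The relation `leftRel U` is then
symmetric, and left translations preserve it. -/
structure IsGyrSymmetric (U : Set G) : Prop where
  gyr_mem : ∀ x y, ∀ z ∈ U, gyr x y z ∈ U
  inv_mem : ∀ z ∈ U, z⁻¹ ∈ U

/-- The left-invariant closeness relation `⊖ x ⊕ y ∈ U` attached to a set `U`, usually a
neighbourhood of the identity. -/
def leftRel (U : Set G) : SetRel G G :=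
  (fun p => p.1⁻¹ * p.2) ⁻¹' U

theorem isRefl_leftRel {U : Set G} (hU : 1 ∈ U) : (leftRel U).IsRefl where
  refl x := by rwa [leftRel, mem_preimage, Gyrogroup.inv_mul_cancel]

namespace IsGyrSymmetric

variable {U V : Set G}

theorem inv_mul_mem_comm (hU : IsGyrSymmetric U) {a b : G} (h : a⁻¹ * b ∈ U) : b⁻¹ * a ∈ U := by
  rw [← Gyrogroup.inv_inv (b⁻¹ * a), inv_mul_inv_rev b a]
  exact hU.inv_mem _ (hU.gyr_mem _ _ _ h)

theorem isSymm_leftRel (hU : IsGyrSymmetric U) : (leftRel U).IsSymm where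
  symm _ _ := hU.inv_mul_mem_comm

theorem mul_inv_mul_mem (hU : IsGyrSymmetric U) {a b c : G} (h : b⁻¹ * (a⁻¹ * c) ∈ U) :
    (a * b)⁻¹ * c ∈ U :=
  mul_inv_mul_eq_gyr a b c ▸ hU.gyr_mem _ _ _ h

theorem isCover_univ (hU : IsGyrSymmetric U) (hV : IsGyrSymmetric V) {H : Set G}
    (hH : IsSubgyrogroup H) (hHU : (leftRel U).IsCover univ H) (hVH : (leftRel V).IsCover U H) :
    (leftRel V).IsCover univ H := by
  intro x _
  obtain ⟨h, hh, hxh⟩ := hHU (mem_univ x)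
  obtain ⟨b, hb, hxb⟩ := hVH (hU.inv_mul_mem_comm hxh)
  exact ⟨h * b, hH.mul_mem h hh b hb,
    hV.inv_mul_mem_comm (hV.mul_inv_mul_mem (hV.inv_mul_mem_comm hxb))⟩

end IsGyrSymmetric

end Algebra

section Topology

variable {G : Type*} [Gyrogroup G] [TopologicalSpace G]

theorem isSuitableSet_diff_one [T1Space G] {S : Set G} (hS : derivedSet S ⊆ {1})
    (hdense : Dense (generatedSubgyrogroup S)) : IsSuitableSet (S \ {1}) where
  isDiscrete := isDiscrete_of_disjoint_derivedSet <|
    disjoint_left.2 fun _ hx hx' => hx.2 (hS (derivedSet_mono _ _ sdiff_subset hx'))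
  isClosed := isClosed_union_of_derivedSet_subset isClosed_singleton
    ((derivedSet_mono _ _ sdiff_subset).trans hS)
  dense := by rwa [generatedSubgyrogroup_diff_one]

/-- Left translation by `⊖ x`, as a homeomorphism with inverse the left translation by `x`. -/
def invMulLeftHomeomorph [ContinuousMul G] (x : G) : G ≃ₜ G where
  toFun y := x⁻¹ * y
  invFun y := x * y
  left_inv := Gyrogroup.mul_inv_cancel_left x
  right_inv := Gyrogroup.inv_mul_cancel_left x
  continuous_toFun := continuous_const.mul continuous_id
  continuous_invFun := continuous_const.mul continuous_id

theorem nhds_eq_comap_inv_mul [ContinuousMul G] (x : G) :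
    𝓝 x = comap (fun y => x⁻¹ * y) (𝓝 1) := by
  have hx : (invMulLeftHomeomorph x).symm 1 = x := Gyrogroup.mul_one x
  have hcomap := (invMulLeftHomeomorph x).comap_nhds_eq 1
  rw [hx] at hcomap
  exact hcomap.symm

variable [StronglyTopologicalGyrogroup G]

theorem hasBasis_nhds_one_isGyrSymmetric :
    (𝓝 (1 : G)).HasBasis (fun U => U ∈ 𝓝 (1 : G) ∧ IsGyrSymmetric U) id := by
  obtain ⟨base, hbasis, hinvariant⟩ :=
    StronglyTopologicalGyrogroup.exists_gyr_invariant_base (G := G)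
  refine hasBasis_self.2 fun t ht => ?_
  obtain ⟨U, hU, hUt⟩ := hbasis.mem_iff.1 ht
  have hgyr : ∀ x y, ∀ z ∈ U, gyr x y z ∈ U := fun x y z hz =>
    (hinvariant U hU x y).subset (mem_image_of_mem _ hz)
  have hinv : (fun z : G => z⁻¹) ⁻¹' U ∈ 𝓝 (1 : G) :=
    continuous_inv.continuousAt.preimage_mem_nhds (by
      rw [Gyrogroup.inv_one]
      exact hbasis.mem_of_mem hU)
  refine ⟨U ∩ (fun z : G => z⁻¹) ⁻¹' U, inter_mem (hbasis.mem_of_mem hU) hinv,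
    ⟨fun x y z hz => ⟨hgyr x y z hz.1, ?_⟩, fun z hz => ⟨hz.2, ?_⟩⟩, inter_subset_left.trans hUt⟩
  · simpa only [mem_preimage, Gyrogroup.map_inv] using hgyr x y _ hz.2
  · simpa only [mem_preimage, Gyrogroup.inv_inv] using hz.1

theorem exists_nhds_one_leftRel_comp_subset {U : Set G} (hU : U ∈ 𝓝 (1 : G)) :
    ∃ V ∈ 𝓝 (1 : G), (leftRel V).comp (leftRel V) ⊆ leftRel U := by
  have hmul : Tendsto (fun p : G × G => p.1 * p.2) (𝓝 1 ×ˢ 𝓝 1) (𝓝 1) := by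
    simpa only [nhds_prod_eq, Gyrogroup.one_mul] using (continuous_mul (M := G)).tendsto (1, 1)
  obtain ⟨V, ⟨hV, hVsymm⟩, hVU⟩ := hasBasis_nhds_one_isGyrSymmetric.prod_self.mem_iff.1 (hmul hU)
  refine ⟨V, hV, ?_⟩
  rintro ⟨a, c⟩ ⟨b, hab, hbc⟩
  rw [leftRel, mem_preimage, ← inv_mul_mul_gyr a b c]
  exact hVU (mk_mem_prod hab (hVsymm.gyr_mem _ _ _ hbc))

/-- The left uniform structure of a strongly topological gyrogroup, with entourages the relations
`leftRel U` for the neighbourhoods `U` of the identity. Gyration-invariance of a base at the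
identity is what makes these relations a uniformity. -/
abbrev leftUniformSpace (G : Type*) [Gyrogroup G] [TopologicalSpace G]
    [StronglyTopologicalGyrogroup G] : UniformSpace G where
  toTopologicalSpace := ‹TopologicalSpace G›
  uniformity := comap (fun p : G × G => p.1⁻¹ * p.2) (𝓝 1)
  symm := by
    rintro s ⟨t, ht, hts⟩
    obtain ⟨U, ⟨hU, hUsymm⟩, hUt⟩ := hasBasis_nhds_one_isGyrSymmetric.mem_iff.1 ht
    exact ⟨U, hU, fun p hp => hts (hUt (hUsymm.inv_mul_mem_comm hp))⟩
  comp := by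
    rintro s ⟨t, ht, hts⟩
    obtain ⟨V, hV, hVt⟩ := exists_nhds_one_leftRel_comp_subset ht
    exact (mem_lift'_sets (monotone_id.relComp monotone_id)).2
      ⟨leftRel V, preimage_mem_comap hV, hVt.trans hts⟩
  nhds_eq_comap_uniformity x := by
    rw [nhds_eq_comap_inv_mul, comap_comap]
    rfl

theorem hasBasis_uniformity_leftRel {ι : Sort*} {p : ι → Prop} {V : ι → Set G}
    (hV : (𝓝 (1 : G)).HasBasis p V) :
    (leftUniformSpace G).uniformity.HasBasis p fun i => leftRel (V i) :=
  hV.comap _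

section T0Space

variable [T0Space G]

theorem t2Space : T2Space G := by
  let := leftUniformSpace G
  infer_instance

theorem derivedSet_eq_empty_of_isSeparated_leftRel {U : Set G} (hU : U ∈ 𝓝 (1 : G)) {A : Set G}
    (hA : (leftRel U).IsSeparated A) : derivedSet A = ∅ := by
  let := leftUniformSpace G
  exact derivedSet_eq_empty_of_isSeparated (preimage_mem_comap hU) hA

theorem exists_derivedSet_eq_empty_isCover {U : Set G} (hU : U ∈ 𝓝 (1 : G))
    (hUsymm : IsGyrSymmetric U) (s : Set G) :
    ∃ A ⊆ s, derivedSet A = ∅ ∧ (leftRel U).IsCover s A := by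
  have := isRefl_leftRel (mem_of_mem_nhds hU)
  have := hUsymm.isSymm_leftRel
  obtain ⟨A, hAs, hAsep, hAcover⟩ := exists_isSeparated_isCover (leftRel U) s
  exact ⟨A, hAs, derivedSet_eq_empty_of_isSeparated_leftRel hU hAsep, hAcover⟩

end T0Space

theorem dense_of_isCover_leftRel {V : ℕ → Set G} (hV : (𝓝 (1 : G)).HasAntitoneBasis V)
    (hVsymm : ∀ n, IsGyrSymmetric (V n)) {H : Set G} (hH : IsSubgyrogroup H)
    (hzero : (leftRel (V 0)).IsCover univ H)
    (hsucc : ∀ n, (leftRel (V (n + 1))).IsCover (V n) H) : Dense H := by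
  let := leftUniformSpace G
  have hcover : ∀ n, (leftRel (V n)).IsCover univ H := fun n => by
    induction n with
    | zero => exact hzero
    | succ n ih => exact (hVsymm n).isCover_univ (hVsymm (n + 1)) hH ih (hsucc n)
  exact dense_of_forall_isCover (hasBasis_uniformity_leftRel hV.1) fun n _ => hcover n

variable [T0Space G] [(𝓝 (1 : G)).IsCountablyGenerated]

theorem metrizableSpace : TopologicalSpace.MetrizableSpace G := by
  let := leftUniformSpace G
  have : (𝓤 G).IsCountablyGenerated :=
    inferInstanceAs (comap (fun p : G × G => p.1⁻¹ * p.2) (𝓝 1)).IsCountablyGenerated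
  exact UniformSpace.metrizableSpace

theorem exists_isSuitableSet : ∃ S : Set G, IsSuitableSet S := by
  have := t2Space (G := G)
  obtain ⟨V, hVsymm, hV⟩ := (hasBasis_nhds_one_isGyrSymmetric (G := G)).exists_antitone_subbasis
  obtain ⟨A, -, hA, hAcover⟩ :=
    exists_derivedSet_eq_empty_isCover (hVsymm 0).1 (hVsymm 0).2 univ
  choose B hBV hB hBcover using fun n =>
    exists_derivedSet_eq_empty_isCover (hVsymm (n + 1)).1 (hVsymm (n + 1)).2 (V n)
  have hBone : Tendsto B cofinite (𝓝 1).smallSets := by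
    rw [Nat.cofinite_eq_atTop, tendsto_smallSets_iff]
    exact fun t ht => (hV.eventually_subset ht).mono fun n => (hBV n).trans
  have hderived : derivedSet (A ∪ ⋃ n, B n) ⊆ {1} := by
    rw [derivedSet_union, hA, empty_union]
    exact derivedSet_iUnion_subset_singleton hBone hB
  have hgen := subset_generatedSubgyrogroup (A ∪ ⋃ n, B n)
  refine ⟨_, isSuitableSet_diff_one hderived ?_⟩
  exact dense_of_isCover_leftRel hV (fun n => (hVsymm n).2)
    (isSubgyrogroup_generatedSubgyrogroup _) (hAcover.mono (subset_union_left.trans hgen))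
    fun n => (hBcover n).mono (((subset_iUnion B n).trans subset_union_right).trans hgen)

end Topology

end Gyrogroup

theorem theorem4p6_general {G : Type*} [Gyrogroup G] [TopologicalSpace G]
    [StronglyTopologicalGyrogroup G] [T0Space G] [(𝓝 (1 : G)).IsCountablyGenerated] :
    TopologicalSpace.MetrizableSpace G ∧ ∃ S : Set G, IsSuitableSet S :=
  ⟨Gyrogroup.metrizableSpace, Gyrogroup.exists_isSuitableSet⟩

theorem theorem4p6 {G : Type*} [Gyrogroup G] [TopologicalSpace G]
    [StronglyTopologicallyOrderableGyrogroup G] (hG : IsGδ ({1} : Set G)) :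
    TopologicalSpace.MetrizableSpace G ∧ ∃ S : Set G, IsSuitableSet S := by
  obtain ⟨_, _⟩ := StronglyTopologicallyOrderableGyrogroup.exists_linearOrder (G := G)
  have := isCountablyGenerated_nhds_of_isGδ_singleton hG
  exact theorem4p6_general
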